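/- Let $K$ be an algebraically closed field of characteristic $p>0$. Consider a finite sequence of local point blowups $b'=b_{n+1}\to b=b_n\to\cdots\to b_1\to b_0$ of a smooth three-dimensional ambient space over $K$ (in the completed local rings): $b_{i+1}$ is a closed point on the exceptional divisor of the blowup with center $b_i$. In local coordinates $(x,y,z)$ at $b_0$ let a surface be defined by $G_0=x^p+F_0(y,z)$ with $F_0\in K[[y,z]]$, and let there be given at $b_0$ a (possibly empty) initial exceptional divisor consisting of some of the hypersurfaces $y=0$, $z=0$. Assume that all centers are equiconstant points, i.e. the strict transform $G_i$ of $G_0$ at $b_i$ has order $p$ for $0\le i\le n$. In the coordinates induced by the blowups, $G_i=x^p+F_i(y,z)$, and the exceptional components through $b_i$ (the strict transforms of the initial ones and of the exceptional divisors of the previous blowups) are among the hypersurfaces $y=0$, $z=0$. Remove from $F_i$ all $p$-th power monomials $y^{\alpha}z^{\beta}$ with $p\mid\alpha$, $p\mid\beta$. The dorder at $b_i$ is the order of the resulting series minus the sum of its orders of vanishing along the exceptional components through $b_i$; that is, if $w^r$ is the maximal product of exceptional components that can be factored from it, say as $w^r\cdot\hat F_i$, then the dorder is $\mathrm{ord}(\hat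 F_i)$. (If $F_i$ is a $p$-th power, the dorder is set to $0$.) Suppose that $b'$ is a kangaroo point with antelope point $b$: $\mathrm{ord}_{b'}(G_{n+1})=\mathrm{ord}_b(G_n)$ and $\mathrm{dorder}_{b'}(F_{n+1})>\mathrm{dorder}_b(F_n)$. Let $b^\circ$ be the last of the points $b_0,\dots,b_n$ at which none of the exceptional components through $b$ has appeared yet (it exists whenever no initial component passes through $b$). Then the dorder has dropped between $b^\circ$ and $b$ at least to its half: $$\mathrm{dorder}_b\ \le\ \tfrac12\,\mathrm{dorder}_{b^\circ}.$$ -/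

import Mathlib

open MvPowerSeries

noncomputable section

namespace Kangaroo

/-- Exponents `(α, β)` of the monomials `y ^ α * z ^ β` that occur in the expansion of `F` modulo
`p`-th powers: those with nonzero coefficient for which `α` and `β` are not both multiples of `p`.
The variables of `F` are `y = X 0` and `z = X 1`. -/
def support {K : Type*} [Field K] (p : ℕ) (F : MvPowerSeries (Fin 2) K) : Set (Fin 2 →₀ ℕ) :=
  {e | coeff e F ≠ 0 ∧ ¬ ∀ w, p ∣ e w}

/-- Order of (the residue class modulo `p`-th powers of) `F`; it is `0` for the zero class. -/
def ord {K : Type*} [Field K] (p : ℕ) (F : MvPowerSeries (Fin 2) K) : ℕ :=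
  sInf ((fun e => e 0 + e 1) '' support p F)

/-- Order of (the residue class modulo `p`-th powers of) `F` along the curve `X w = 0`;
it is `0` for the zero class. -/
def ordAlong {K : Type*} [Field K] (p : ℕ) (w : Fin 2) (F : MvPowerSeries (Fin 2) K) : ℕ :=
  sInf ((fun e => e w) '' support p F)

/-- The dorder of `F` with respect to the exceptional divisor whose components are the curves
`X w = 0`, `w ∈ E`: the order that remains after all exceptional components have been factored
from `F` modulo `p`-th powers. (The subtraction never truncates.) -/
def dorder {K : Type*} [Field K] (p : ℕ) (E : Finset (Fin 2)) (F : MvPowerSeries (Fin 2) K) : ℕ :=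
  ord p F - ∑ w ∈ E, ordAlong p w F

/-- The series `G = x ^ p + F(y, z)` in `K[[x, y, z]]`, where `x = X 0`, `y = X 1`, `z = X 2`. -/
def surface {K : Type*} [Field K] (p : ℕ) (F : MvPowerSeries (Fin 2) K) :
    MvPowerSeries (Fin 3) K :=
  X 0 ^ p + subst (fun w : Fin 2 => (X w.succ : MvPowerSeries (Fin 3) K)) F

/-- The blowup of the origin of three-space, in the chart of the variable `v = X k.succ`
(`v` is `y` for `k = 0` and `z` for `k = 1`), centered at the closed point of the exceptional
divisor `v = 0` where `x` takes the value `c` and the third variable takes the value `t`: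
`x ↦ v * (x + c)`, `v ↦ v`, `w ↦ v * (w + t)` for the third variable `w`.
Every closed point of the exceptional divisor has this form, except the origin of the `x`-chart;
the strict transform of a surface `x ^ p + F(y, z)` of order `p` never passes through that one. -/
def blowup {K : Type*} [Field K] (k : Fin 2) (c t : K) : Fin 3 → MvPowerSeries (Fin 3) K :=
  fun i =>
    if i = k.succ then X k.succ
    else if i = 0 then X k.succ * (X 0 + C c)
    else X k.succ * (X i + C t)

/-- `G'` is the strict transform of the hypersurface germ `G` under the local point blowup
`blowup k c t`: the total transform of `G` divided by the exceptional variable to the power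
`order G`. -/
def IsStrictTransform {K : Type*} [Field K] (k : Fin 2) (c t : K)
    (G G' : MvPowerSeries (Fin 3) K) : Prop :=
  subst (blowup k c t) G = X k.succ ^ (order G).toNat * G'

/-- A sequence of `N` local point blowups `b_N → ⋯ → b_1 → b_0` of a smooth three-dimensional
ambient space and the strict transforms `G_i = x ^ p + F_i(y, z)` at `b_i` of a purely inseparable
surface. The point `b_{i+1}` is a closed point on the exceptional divisor of the blowup with
center `b_i`, and all centers `b_0, …, b_{N-1}` are points where the order of the surface is `p`
(equiconstant points). The coordinates at `b_{i+1}` are those induced from `b_i` by the blowup;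
in them all exceptional components through `b_{i+1}` are coordinate hypersurfaces.
`E₀` is the exceptional divisor through `b_0` (possibly empty): it consists of the
hypersurfaces `X w.succ = 0`, `w ∈ E₀`. -/
structure BlowupSequence (K : Type*) [Field K] (p N : ℕ) where
  F : ℕ → MvPowerSeries (Fin 2) K
  E₀ : Finset (Fin 2)
  chart : ℕ → Fin 2
  c : ℕ → K
  t : ℕ → K
  strict : ∀ i < N,
    IsStrictTransform (chart i) (c i) (t i) (surface p (F i)) (surface p (F (i + 1)))
  order_center : ∀ i < N, order (surface p (F i)) = p

namespace BlowupSequence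

variable {K : Type*} [Field K] {p N : ℕ} (B : BlowupSequence K p N)

/-- `B.born i w = some m` means that the coordinate hypersurface `X w.succ = 0` at `b_i` is an
exceptional component which has appeared at `b_m` (for `m = 0`, a component of `E₀`; for `m ≥ 1`,
the strict transform at `b_i` of the exceptional divisor of the blowup with center `b_{m-1}`).
`B.born i w = none` means that `X w.succ = 0` is not an exceptional component at `b_i`.
At `b_{i+1}` the new component is the hypersurface of the chart variable. The old component
`X (chart i).succ = 0` has empty strict transform in this chart, and the strict transform of the
other coordinate hypersurface passes through `b_{i+1}` if and only if `t i = 0`. -/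
def born : ℕ → Fin 2 → Option ℕ
  | 0, w => if w ∈ B.E₀ then some 0 else none
  | i + 1, w =>
    open Classical in
    if w = B.chart i then some (i + 1) else if B.t i = 0 then born i w else none

/-- The exceptional components through `b_i`. -/
def exc (i : ℕ) : Finset (Fin 2) := Finset.univ.filter fun w => (B.born i w).isSome

/-- The dorder of the surface at `b_i`. -/
def dorderAt (i : ℕ) : ℕ := dorder p (B.exc i) (B.F i)

/-- `b_{i+1}` is a kangaroo point and `b_i` is its antelope point: the order of the surface is the
same at both points, and the dorder increases. -/
def IsKangaroo (i : ℕ) : Prop :=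
  order (surface p (B.F (i + 1))) = order (surface p (B.F i)) ∧ B.dorderAt i < B.dorderAt (i + 1)

/-- `b_j` is the last point below (or equal to) `b_i` at which none of the exceptional components
through `b_i` has appeared yet. -/
def IsLastBefore (i j : ℕ) : Prop :=
  IsGreatest {j | j ≤ i ∧ ∀ w m, B.born i w = some m → j < m} j

end BlowupSequence

end Kangaroo

end

/-! Setting `x = 0` reduces everything to blowups of plane series modulo `p`-th powers: the terms of
degree `m + p` of `F`, dehomogenized and translated by `t`, become the terms of `F'` of degree `m`
in the chart variable.

At the antelope, let `r`, `s` be the exceptional orders and `d > 0` the dorder. The initial form has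
exponents in an interval of length `d`. A larger dorder afterwards forces `t ≠ 0` and, up to `p`-th
powers, a zero of order at least `d + 1` at `t`. This is too much for such a polynomial unless `p`
divides the degree. In that case its derivative, multiplied by the variable, is a monomial times a
constant times `(X - t) ^ d`. So both extreme monomials occur and `r`, `s` are prime to `p`
(`mem_support_of_dorder_lt`); in particular both coordinate curves are exceptional.

Their components are born at different points, the older one at `b_{j+1}`. As it survives up to the
antelope, all blowups from `b_{j+1}` to `b_n` are monomial in the other chart. Undoing `q` of them
shears the exponents and stretches the gap `d` between the two extreme monomials to `(q + 1) * d`. A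
last step back to `b_j` turns this gap into a lower bound for the dorder (`le_dorder`,
`succ_mul_le_dorder`). Since the births differ, `q ≥ 1`, whence the factor 2. -/

namespace Kangaroo

/-! ### Exponents in two variables -/

/-- The exponent of the monomial `X k ^ a * X k.rev ^ b`. -/
noncomputable def expo (k : Fin 2) (a b : ℕ) : Fin 2 →₀ ℕ :=
  Finsupp.single k a + Finsupp.single k.rev b

lemma rev_ne_self (k : Fin 2) : k.rev ≠ k := by
  revert k; decide

lemma eq_or_eq_rev (k w : Fin 2) : w = k ∨ w = k.rev := by
  revert k w; decide

@[simp] lemma expo_self (k : Fin 2) (a b : ℕ) : expo k a b k = a := by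
  simp [expo, rev_ne_self]

@[simp] lemma expo_apply_rev (k : Fin 2) (a b : ℕ) : expo k a b k.rev = b := by
  simp [expo, (rev_ne_self k).symm]

lemma ext_rev {k : Fin 2} {e e' : Fin 2 →₀ ℕ} (h : e k = e' k) (h' : e k.rev = e' k.rev) :
    e = e' := by
  ext w
  rcases eq_or_eq_rev k w with rfl | rfl <;> assumption

lemma expo_eta (k : Fin 2) (e : Fin 2 →₀ ℕ) : expo k (e k) (e k.rev) = e :=
  ext_rev (k := k) (by simp) (by simp)

lemma expo_inj {k : Fin 2} {a b a' b' : ℕ} : expo k a b = expo k a' b' ↔ a = a' ∧ b = b' := by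
  refine ⟨fun h => ⟨?_, ?_⟩, fun h => by rw [h.1, h.2]⟩
  · simpa using DFunLike.congr_fun h k
  · simpa using DFunLike.congr_fun h k.rev

lemma expo_rev (k : Fin 2) (a b : ℕ) : expo k.rev b a = expo k a b := by
  simp [expo, add_comm]

lemma expo_zero_add_one (k : Fin 2) (a b : ℕ) : expo k a b 0 + expo k a b 1 = a + b := by
  rcases eq_or_eq_rev 0 k with rfl | rfl <;> simp [expo, add_comm]

lemma expo_le {k : Fin 2} {a b a' b' : ℕ} : expo k a b ≤ expo k a' b' ↔ a ≤ a' ∧ b ≤ b' := by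
  refine ⟨fun h => ⟨by simpa using h k, by simpa using h k.rev⟩, fun h w => ?_⟩
  rcases eq_or_eq_rev k w with rfl | rfl <;> simp [h.1, h.2]

lemma expo_sub (k : Fin 2) (a b a' b' : ℕ) :
    expo k a b - expo k a' b' = expo k (a - a') (b - b') :=
  ext_rev (k := k) (by simp) (by simp)

variable {K : Type*} [Field K]

/-! ### Point blowups in the plane -/

/-- The blowup of the origin of the plane in the chart of `X k`, centered at the point `t` of the
exceptional curve. -/
noncomputable def planeBlowup (k : Fin 2) (t : K) : Fin 2 → MvPowerSeries (Fin 2) K :=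
  fun i => if i = k then X k else X k * (X i + C t)

/-- The homogeneous part of degree `m` of `F`, dehomogenized by `X k = 1`. -/
noncomputable def slice (k : Fin 2) (F : MvPowerSeries (Fin 2) K) (m : ℕ) : Polynomial K :=
  ∑ i ∈ Finset.range (m + 1), Polynomial.monomial i (coeff (expo k (m - i) i) F)

lemma coeff_slice (k : Fin 2) (F : MvPowerSeries (Fin 2) K) (m i : ℕ) :
    (slice k F m).coeff i = if i ≤ m then coeff (expo k (m - i) i) F else 0 := by
  simp [slice, Polynomial.coeff_monomial]

lemma hasSubst_planeBlowup (k : Fin 2) (t : K) : HasSubst (planeBlowup k t) := by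
  refine hasSubst_of_constantCoeff_zero fun i => ?_
  unfold planeBlowup
  split_ifs <;> simp

lemma hasSubst_blowup (k : Fin 2) (c t : K) : HasSubst (blowup k c t) := by
  refine hasSubst_of_constantCoeff_zero fun i => ?_
  unfold blowup
  split_ifs <;> simp

/-! ### Reduction from surfaces in three-space to series in the plane -/

lemma hasSubst_succ : HasSubst (fun w : Fin 2 => (X w.succ : MvPowerSeries (Fin 3) K)) :=
  hasSubst_of_constantCoeff_zero fun i => by simp

/-- The substitution `x = 0`. -/
noncomputable def restrict : Fin 3 → MvPowerSeries (Fin 2) K :=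
  Fin.cons 0 X

lemma hasSubst_restrict : HasSubst (restrict (K := K)) :=
  hasSubst_of_constantCoeff_zero fun i => by
    refine Fin.cases ?_ (fun j => ?_) i <;> simp [restrict]

lemma subst_restrict_X_zero : subst (restrict (K := K)) (X 0 : MvPowerSeries (Fin 3) K) = 0 := by
  rw [subst_X hasSubst_restrict]; rfl

lemma subst_restrict_X_succ (w : Fin 2) :
    subst (restrict (K := K)) (X w.succ : MvPowerSeries (Fin 3) K) = X w := by
  rw [subst_X hasSubst_restrict]; rfl

lemma subst_restrict_subst_succ (F : MvPowerSeries (Fin 2) K) :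
    subst (restrict (K := K))
      (subst (fun w : Fin 2 => (X w.succ : MvPowerSeries (Fin 3) K)) F) = F := by
  rw [subst_comp_subst_apply hasSubst_succ hasSubst_restrict]
  simp_rw [subst_restrict_X_succ]
  rw [show (fun s : Fin 2 => (X s : MvPowerSeries (Fin 2) K)) = X from rfl, subst_self]
  rfl

lemma subst_restrict_blowup_succ (k : Fin 2) (c t : K) (w : Fin 2) :
    subst (restrict (K := K)) (blowup k c t w.succ) = planeBlowup k t w := by
  by_cases h : w = k
  · subst h
    simp [blowup, planeBlowup, subst_restrict_X_succ]
  · simp [blowup, planeBlowup, h, subst_mul hasSubst_restrict, subst_add hasSubst_restrict,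
      subst_restrict_X_succ]

lemma subst_restrict_blowup_surface {p : ℕ} (k : Fin 2) (c t : K) (F : MvPowerSeries (Fin 2) K) :
    subst (restrict (K := K)) (subst (blowup k c t) (surface p F)) =
      (X k * C c) ^ p + subst (planeBlowup k t) F := by
  have h0 : subst (restrict (K := K)) (blowup k c t 0) = X k * C c := by
    have : (0 : Fin 3) ≠ k.succ := (Fin.succ_ne_zero k).symm
    simp [blowup, this, subst_mul hasSubst_restrict, subst_add hasSubst_restrict,
      subst_restrict_X_succ, subst_restrict_X_zero]
  rw [surface, subst_add (hasSubst_blowup k c t), subst_pow (hasSubst_blowup k c t),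
    subst_X (hasSubst_blowup k c t), subst_comp_subst_apply hasSubst_succ (hasSubst_blowup k c t),
    subst_add hasSubst_restrict, subst_pow hasSubst_restrict, h0]
  congr 1
  simp_rw [subst_X (hasSubst_blowup k c t)]
  rw [subst_comp_subst_apply]
  · simp_rw [subst_restrict_blowup_succ]
  · exact hasSubst_of_constantCoeff_zero fun i => by
      simp only [blowup]; split_ifs <;> simp
  · exact hasSubst_restrict

/-- Restriction to `x = 0` kills the new `x ^ p`, while the old one leaves a trace only through the
translation `c`. -/
lemma X_pow_mul_eq_of_isStrictTransform {p : ℕ} (hp : p ≠ 0) {k : Fin 2} {c t : K}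
    {F F' : MvPowerSeries (Fin 2) K} (hF : order (surface p F) = p)
    (h : IsStrictTransform k c t (surface p F) (surface p F')) :
    (X k * C c) ^ p + subst (planeBlowup k t) F = X k ^ p * F' := by
  rw [← subst_restrict_blowup_surface, show subst _ _ = _ from h, hF, subst_mul hasSubst_restrict,
    subst_pow hasSubst_restrict, subst_restrict_X_succ, surface, subst_add hasSubst_restrict,
    subst_pow hasSubst_restrict, subst_restrict_X_zero, subst_restrict_subst_succ]
  simp [hp]

/-! ### Coefficients of plane transforms -/

lemma coeff_X_pow_mul_expo (k : Fin 2) (n m l : ℕ) (G : MvPowerSeries (Fin 2) K) :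
    coeff (expo k m l) (X k ^ n * G) = if n ≤ m then coeff (expo k (m - n) l) G else 0 := by
  have : (Finsupp.single k n : Fin 2 →₀ ℕ) = expo k n 0 := by simp [expo]
  simp [X_pow_eq, coeff_monomial_mul, this, expo_le, expo_sub]

lemma coeff_X_rev_add_C_pow (k : Fin 2) (t : K) (n l : ℕ) :
    coeff (expo k 0 l) ((X k.rev + C t : MvPowerSeries (Fin 2) K) ^ n) =
      ((Polynomial.X + Polynomial.C t) ^ n).coeff l := by
  have h1 : (X k.rev + C t : MvPowerSeries (Fin 2) K) ^ n =
      ∑ m ∈ Finset.range (n + 1), C (t ^ (n - m) * (n.choose m : K)) * X k.rev ^ m := by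
    rw [add_pow]
    refine Finset.sum_congr rfl fun m _ => ?_
    simp only [map_mul, map_pow, map_natCast]; ring
  have h2 : ∀ m, coeff (expo k 0 l) (X k.rev ^ m : MvPowerSeries (Fin 2) K) =
      if l = m then 1 else 0 := by
    intro m
    have : (Finsupp.single k.rev m : Fin 2 →₀ ℕ) = expo k 0 m := by simp [expo]
    simp [coeff_X_pow, this, expo_inj]
  rw [h1, map_sum, Polynomial.coeff_X_add_C_pow]
  simp only [coeff_C_mul, h2, mul_ite, mul_one, mul_zero, Finset.sum_ite_eq, Finset.mem_range,
    Nat.lt_succ_iff]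
  split_ifs with hl
  · rfl
  · rw [Nat.choose_eq_zero_of_lt (by omega)]; simp

lemma coeff_X_rev_add_C_pow_of_ne (k : Fin 2) (t : K) (n m l : ℕ) (hm : m ≠ 0) :
    coeff (expo k m l) ((X k.rev + C t : MvPowerSeries (Fin 2) K) ^ n) = 0 := by
  rw [add_pow, map_sum]
  refine Finset.sum_eq_zero fun i _ => ?_
  have : (Finsupp.single k.rev i : Fin 2 →₀ ℕ) = expo k 0 i := by simp [expo]
  rw [← map_pow, ← map_natCast (C (σ := Fin 2) (R := K)), mul_assoc, ← map_mul, mul_comm,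
    coeff_C_mul, coeff_X_pow, this, if_neg (fun h => hm (expo_inj.mp h).1), mul_zero]

lemma coeff_subst_planeBlowup (k : Fin 2) (t : K) (F : MvPowerSeries (Fin 2) K) (m l : ℕ) :
    coeff (expo k m l) (subst (planeBlowup k t) F) =
      (Polynomial.taylor t (slice k F m)).coeff l := by
  have key : ∀ d : Fin 2 →₀ ℕ, coeff (expo k m l)
      (d.prod fun s e => (planeBlowup k t s) ^ e) =
      if d k + d k.rev = m then ((Polynomial.X + Polynomial.C t) ^ (d k.rev)).coeff l else 0 := by
    intro d
    have h1 : (d.prod fun s e => (planeBlowup k t s) ^ e) =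
        X k ^ (d k + d k.rev) * (X k.rev + C t) ^ (d k.rev) := by
      rw [Finsupp.prod_fintype _ _ (fun _ => pow_zero _), Fin.prod_univ_two]
      rcases eq_or_eq_rev 0 k with rfl | rfl <;>
        simp [planeBlowup, pow_add, mul_pow] <;> ring
    rw [h1, coeff_X_pow_mul_expo]
    rcases lt_trichotomy (d k + d k.rev) m with h | h | h
    · rw [if_pos h.le, if_neg h.ne, coeff_X_rev_add_C_pow_of_ne _ _ _ _ _ (by omega)]
    · rw [if_pos h.le, if_pos h, h, Nat.sub_self, coeff_X_rev_add_C_pow]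
    · rw [if_neg (by omega), if_neg (by omega)]
  rw [coeff_subst (hasSubst_planeBlowup k t), slice, map_sum, Polynomial.finsetSum_coeff]
  simp only [key, Polynomial.taylor_monomial, Polynomial.coeff_C_mul, smul_eq_mul]
  have hinj : Set.InjOn (fun i => expo k (m - i) i) (Finset.range (m + 1) : Set ℕ) :=
    fun i _ j _ hij => (expo_inj.mp hij).2
  rw [finsum_eq_sum_of_support_subset (s := (Finset.range (m + 1)).image fun i => expo k (m - i) i),
    Finset.sum_image hinj]
  · refine Finset.sum_congr rfl fun i hi => ?_
    have := Finset.mem_range.mp hi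
    rw [expo_self, expo_apply_rev, if_pos (by omega)]
  · intro d hd
    have : d k + d k.rev = m := by
      by_contra h
      simp [h] at hd
    simp only [Finset.coe_image, Set.mem_image, Finset.mem_coe, Finset.mem_range]
    exact ⟨d k.rev, by omega, by rw [← this, Nat.add_sub_cancel, expo_eta]⟩

/-- `F'` arises from `F` by a blowup of the origin at the point `t` of the exceptional curve in the
chart of `X k` and division by the `p`-th power of `X k`, up to constants. -/
def IsTransform (p : ℕ) (k : Fin 2) (t : K) (F F' : MvPowerSeries (Fin 2) K) : Prop :=
  (∀ m < p, slice k F m = 0) ∧ ∀ m l, m ≠ 0 ∨ l ≠ 0 →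
    coeff (expo k m l) F' = (Polynomial.taylor t (slice k F (m + p))).coeff l

/-- The translation `c` contributes only `c ^ p * X k ^ p`, hence only a constant after division.
Constants are `p`-th powers, so the excluded exponent is harmless. -/
lemma IsStrictTransform.isTransform {p : ℕ} (hp : p ≠ 0) {k : Fin 2} {c t : K}
    {F F' : MvPowerSeries (Fin 2) K} (hF : order (surface p F) = p)
    (h : IsStrictTransform k c t (surface p F) (surface p F')) : IsTransform p k t F F' := by
  have h1 := X_pow_mul_eq_of_isStrictTransform hp hF h
  rw [mul_pow] at h1
  have h2 : ∀ m l, (if p ≤ m then coeff (expo k (m - p) l) (C (c ^ p) : MvPowerSeries (Fin 2) K)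
      else 0) + (Polynomial.taylor t (slice k F m)).coeff l =
      if p ≤ m then coeff (expo k (m - p) l) F' else 0 := by
    intro m l
    rw [← coeff_X_pow_mul_expo, ← coeff_X_pow_mul_expo, ← h1, ← coeff_subst_planeBlowup, map_add,
      map_pow]
  refine ⟨fun m hm => ?_, fun m l hml => ?_⟩
  · rw [← Polynomial.taylor_eq_zero (r := t)]
    ext l
    simpa [hm.not_ge] using h2 m l
  · have h3 := h2 (m + p) l
    have h4 : expo k m l ≠ 0 := by
      rw [show (0 : Fin 2 →₀ ℕ) = expo k 0 0 by simp [expo], Ne, expo_inj]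
      tauto
    rw [if_pos (Nat.le_add_left p m), if_pos (Nat.le_add_left p m), Nat.add_sub_cancel, coeff_C,
      if_neg h4, zero_add] at h3
    exact h3.symm

end Kangaroo

/-! ### Polynomials with few consecutive monomials -/

namespace Polynomial

variable {K : Type*} [Field K]

lemma exists_eq_X_pow_mul_of_coeff {U : K[X]} {s d : ℕ}
    (h : ∀ i, U.coeff i ≠ 0 → s ≤ i ∧ i ≤ s + d) : ∃ W : K[X], U = X ^ s * W ∧ W.natDegree ≤ d := by
  obtain ⟨W, rfl⟩ := X_pow_dvd_iff.mpr fun i (hi : i < s) => by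
    by_contra hne
    exact absurd (h i hne).1 (by omega)
  refine ⟨W, rfl, natDegree_le_iff_coeff_eq_zero.mpr fun i hi => ?_⟩
  by_contra hne
  have := (h (i + s) (by rwa [coeff_X_pow_mul])).2
  omega

lemma X_sub_C_pow_dvd_of_dvd_X_pow_mul {W : K[X]} {t : K} (ht : t ≠ 0) {s n : ℕ}
    (h : (X - C t) ^ n ∣ X ^ s * W) : (X - C t) ^ n ∣ W := by
  refine (IsCoprime.pow ?_).dvd_of_dvd_mul_left h
  simpa using isCoprime_X_sub_C_of_isUnit_sub (R := K) (a := t) (b := 0) (by simpa using ht)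

/-- A nonzero polynomial whose monomials have exponents in `[s, s + d]` has roots of multiplicity
at most `d` outside zero. -/
lemma le_of_X_sub_C_pow_dvd {U : K[X]} (hU : U ≠ 0) {s d n : ℕ} {t : K} (ht : t ≠ 0)
    (h : ∀ i, U.coeff i ≠ 0 → s ≤ i ∧ i ≤ s + d) (hdvd : (X - C t) ^ n ∣ U) : n ≤ d := by
  obtain ⟨W, rfl, hW⟩ := exists_eq_X_pow_mul_of_coeff h
  have h1 := natDegree_le_of_dvd (X_sub_C_pow_dvd_of_dvd_X_pow_mul ht hdvd) (right_ne_zero_of_mul hU)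
  rw [natDegree_pow, natDegree_X_sub_C, mul_one] at h1
  omega

/-- If the multiplicity of such a root attains the bound, both extreme monomials occur. -/
lemma coeff_ne_zero_of_X_sub_C_pow_dvd {U : K[X]} (hU : U ≠ 0) {s d : ℕ} {t : K} (ht : t ≠ 0)
    (h : ∀ i, U.coeff i ≠ 0 → s ≤ i ∧ i ≤ s + d) (hdvd : (X - C t) ^ d ∣ U) :
    U.coeff s ≠ 0 ∧ U.coeff (s + d) ≠ 0 := by
  obtain ⟨W, rfl, hW⟩ := exists_eq_X_pow_mul_of_coeff h
  obtain ⟨V, rfl⟩ := X_sub_C_pow_dvd_of_dvd_X_pow_mul ht hdvd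
  have hV : V ≠ 0 := by rintro rfl; simp at hU
  have hP : (X - C t) ^ d ≠ 0 := pow_ne_zero _ (X_sub_C_ne_zero t)
  rw [natDegree_mul hP hV, natDegree_pow, natDegree_X_sub_C, mul_one] at hW
  -- The degree bound is exhausted, so `U` is a scalar multiple of `X ^ s * (X - C t) ^ d`.
  obtain ⟨v, rfl⟩ := natDegree_eq_zero.mp (show V.natDegree = 0 by omega)
  have hv : v ≠ 0 := by rintro rfl; simp at hV
  constructor
  · have := coeff_X_pow_mul ((X - C t) ^ d * C v) s 0
    rw [zero_add] at this
    rw [this, coeff_mul_C, coeff_zero_eq_eval_zero]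
    simp [ht, hv]
  · have h1 : ((X - C t) ^ d).coeff d = 1 := by
      have := (monic_X_sub_C t).pow d
      rwa [Monic, leadingCoeff, natDegree_pow, natDegree_X_sub_C, mul_one] at this
    rw [add_comm, coeff_X_pow_mul, coeff_mul_C, h1, one_mul]
    exact hv

lemma X_sub_C_pow_dvd_of_X_pow_dvd_taylor {U : K[X]} {t : K} {n : ℕ} (h : X ^ n ∣ taylor t U) :
    (X - C t) ^ n ∣ U := by
  obtain ⟨V, hV⟩ := h
  refine ⟨taylor (-t) V, ?_⟩
  have := congrArg (taylor (-t)) hV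
  rw [taylor_taylor, neg_add_cancel, taylor_zero, taylor_mul, taylor_pow, taylor_X] at this
  rw [this, map_neg, sub_eq_add_neg]

lemma derivative_taylor' (t : K) (U : K[X]) :
    derivative (taylor t U) = taylor t (derivative U) := by
  simp [taylor_apply, derivative_comp]

end Polynomial

namespace Kangaroo

variable {K : Type*} [Field K]

/-! ### Supports modulo `p`-th powers -/

lemma expo_mem_support {p : ℕ} {k : Fin 2} {a b : ℕ} {F : MvPowerSeries (Fin 2) K} :
    expo k a b ∈ support p F ↔ coeff (expo k a b) F ≠ 0 ∧ ¬ (p ∣ a ∧ p ∣ b) := by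
  refine and_congr_right fun _ => not_congr ⟨fun h => ?_, fun h w => ?_⟩
  · exact ⟨by simpa using h k, by simpa using h k.rev⟩
  · rcases eq_or_eq_rev k w with rfl | rfl <;> simp [h.1, h.2]

lemma ord_le {p : ℕ} {k : Fin 2} {a b : ℕ} {F : MvPowerSeries (Fin 2) K}
    (h : expo k a b ∈ support p F) : ord p F ≤ a + b :=
  Nat.sInf_le ⟨_, h, expo_zero_add_one k a b⟩

lemma ordAlong_le {p : ℕ} {k : Fin 2} {a b : ℕ} {F : MvPowerSeries (Fin 2) K}
    (h : expo k a b ∈ support p F) : ordAlong p k F ≤ a :=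
  Nat.sInf_le ⟨_, h, expo_self k a b⟩

lemma exists_mem_support_ord {p : ℕ} (k : Fin 2) {F : MvPowerSeries (Fin 2) K}
    (h : (support p F).Nonempty) : ∃ a b, expo k a b ∈ support p F ∧ a + b = ord p F := by
  obtain ⟨e, he, h'⟩ := Nat.sInf_mem (h.image fun e => e 0 + e 1)
  refine ⟨e k, e k.rev, by rwa [expo_eta], ?_⟩
  rw [← expo_zero_add_one k, expo_eta]
  exact h'

lemma le_ordAlong {p : ℕ} {k : Fin 2} {n : ℕ} {F : MvPowerSeries (Fin 2) K}
    (hF : (support p F).Nonempty) (h : ∀ a b, expo k a b ∈ support p F → n ≤ a) :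
    n ≤ ordAlong p k F := by
  obtain ⟨e, he, h'⟩ := Nat.sInf_mem (hF.image fun e => e k)
  rw [ordAlong, ← h']
  exact h (e k) (e k.rev) (by rwa [expo_eta])

/-- The order of `F` along the curve `X w = 0` if it is exceptional, and `0` otherwise. -/
noncomputable def excOrd (p : ℕ) (E : Finset (Fin 2)) (w : Fin 2) (F : MvPowerSeries (Fin 2) K) :
    ℕ :=
  if w ∈ E then ordAlong p w F else 0

lemma excOrd_le {p : ℕ} {E : Finset (Fin 2)} {k : Fin 2} {a b : ℕ} {F : MvPowerSeries (Fin 2) K}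
    (h : expo k a b ∈ support p F) : excOrd p E k F ≤ a := by
  unfold excOrd
  split_ifs
  exacts [ordAlong_le h, Nat.zero_le a]

lemma excOrd_rev_le {p : ℕ} {E : Finset (Fin 2)} {k : Fin 2} {a b : ℕ}
    {F : MvPowerSeries (Fin 2) K} (h : expo k a b ∈ support p F) : excOrd p E k.rev F ≤ b :=
  excOrd_le (a := b) (b := a) (by rwa [expo_rev])

lemma dorder_eq (p : ℕ) (E : Finset (Fin 2)) (k : Fin 2) (F : MvPowerSeries (Fin 2) K) :
    dorder p E F = ord p F - (excOrd p E k F + excOrd p E k.rev F) := by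
  have h : ∑ w ∈ E, ordAlong p w F = ∑ w, excOrd p E w F := by
    simp only [excOrd, Finset.sum_ite_mem, Finset.univ_inter]
  rw [dorder, h, Fin.sum_univ_two]
  rcases eq_or_eq_rev 0 k with rfl | rfl <;> simp [add_comm]

lemma ord_eq_add_dorder {p : ℕ} (E : Finset (Fin 2)) (k : Fin 2) {F : MvPowerSeries (Fin 2) K}
    (hF : (support p F).Nonempty) :
    ord p F = excOrd p E k F + excOrd p E k.rev F + dorder p E F := by
  obtain ⟨a, b, h, hab⟩ := exists_mem_support_ord k hF
  have h1 := excOrd_le (E := E) h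
  have h2 := excOrd_rev_le (E := E) h
  rw [dorder_eq p E k]
  omega

lemma support_nonempty_of_dorder_pos {p : ℕ} {E : Finset (Fin 2)} {F : MvPowerSeries (Fin 2) K}
    (h : 0 < dorder p E F) : (support p F).Nonempty := by
  by_contra hF
  rw [Set.not_nonempty_iff_eq_empty] at hF
  simp [dorder, ord, hF] at h

/-! ### Supports under blowup -/

variable {p : ℕ}

lemma coeff_slice_of_le {k : Fin 2} {F : MvPowerSeries (Fin 2) K} {m i : ℕ} (h : i ≤ m) :
    (slice k F m).coeff i = coeff (expo k (m - i) i) F := by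
  rw [coeff_slice, if_pos h]

lemma mem_support_of_coeff_slice_ne_zero {k : Fin 2} {F : MvPowerSeries (Fin 2) K} {m i : ℕ}
    (h : (slice k F m).coeff i ≠ 0) (hp : ¬ (p ∣ m ∧ p ∣ i)) :
    i ≤ m ∧ expo k (m - i) i ∈ support p F := by
  rw [coeff_slice] at h
  split_ifs at h with hi
  · refine ⟨hi, expo_mem_support.mpr ⟨h, fun h' => hp ⟨?_, h'.2⟩⟩⟩
    simpa [Nat.sub_add_cancel hi] using dvd_add h'.1 h'.2
  · exact absurd rfl h

lemma coeff_slice_ne_zero_of_mem_support {k : Fin 2} {F : MvPowerSeries (Fin 2) K} {a b : ℕ}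
    (h : expo k a b ∈ support p F) :
    (slice k F (a + b)).coeff b ≠ 0 ∧ ¬ (p ∣ a + b ∧ p ∣ b) := by
  obtain ⟨h1, h2⟩ := expo_mem_support.mp h
  refine ⟨by rwa [coeff_slice_of_le (by omega), Nat.add_sub_cancel], fun h' => h2 ⟨?_, h'.2⟩⟩
  exact (Nat.dvd_add_left h'.2).mp h'.1

lemma derivative_eq_zero_iff_coeff [CharP K p] {U : Polynomial K} :
    Polynomial.derivative U = 0 ↔ ∀ i, U.coeff i ≠ 0 → p ∣ i := by
  constructor
  · intro h i hi
    rcases i with _ | i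
    · exact dvd_zero p
    · have := congrArg (fun P => P.coeff i) h
      simp only [Polynomial.coeff_derivative, Polynomial.coeff_zero] at this
      rw [← CharP.cast_eq_zero_iff K]
      push_cast
      exact (mul_eq_zero.mp this).resolve_left hi
  · intro h
    ext i
    rw [Polynomial.coeff_derivative, Polynomial.coeff_zero]
    by_cases hi : U.coeff (i + 1) = 0
    · rw [hi, zero_mul]
    · have := (CharP.cast_eq_zero_iff K p _).mpr (h _ hi)
      push_cast at this
      rw [this, mul_zero]

/-- Translation preserves being nonzero modulo `p`-th powers: this means `U' ≠ 0` if `p ∣ m`, and `U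
≠ 0` otherwise. -/
lemma exists_coeff_taylor_iff [CharP K p] (U : Polynomial K) (m : ℕ) (t : K) :
    (∃ l, (Polynomial.taylor t U).coeff l ≠ 0 ∧ ¬ (p ∣ m ∧ p ∣ l)) ↔
      ∃ l, U.coeff l ≠ 0 ∧ ¬ (p ∣ m ∧ p ∣ l) := by
  by_cases hm : p ∣ m
  · have key : ∀ V : Polynomial K, (∃ l, V.coeff l ≠ 0 ∧ ¬ (p ∣ m ∧ p ∣ l)) ↔
        Polynomial.derivative V ≠ 0 := fun V => by
      rw [Ne, derivative_eq_zero_iff_coeff (p := p)]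
      simp [hm]
    rw [key, key, Polynomial.derivative_taylor', Ne, Polynomial.taylor_eq_zero]
  · have key : ∀ V : Polynomial K, (∃ l, V.coeff l ≠ 0 ∧ ¬ (p ∣ m ∧ p ∣ l)) ↔ V ≠ 0 := fun V => by
      simp [hm, Polynomial.ext_iff]
    rw [key, key, Ne, Polynomial.taylor_eq_zero]

namespace IsTransform

variable {k : Fin 2} {t : K} {F F' : MvPowerSeries (Fin 2) K}

lemma le_of_mem (h : IsTransform p k t F F') {a b : ℕ} (hF : expo k a b ∈ support p F) :
    p ≤ a + b := by
  by_contra hlt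
  have := (coeff_slice_ne_zero_of_mem_support hF).1
  rw [h.1 _ (by omega)] at this
  simp at this

lemma mem_iff (h : IsTransform p k t F F') {m l : ℕ} :
    expo k m l ∈ support p F' ↔
      (Polynomial.taylor t (slice k F (m + p))).coeff l ≠ 0 ∧ ¬ (p ∣ m + p ∧ p ∣ l) := by
  rw [expo_mem_support, Nat.dvd_add_self_right]
  refine and_congr_left fun hp => ?_
  rw [h.2 m l]
  by_contra h0
  push Not at h0
  exact hp (by simp [h0.1, h0.2])

/-- This makes the order of `F'` along the new exceptional curve equal to the order of `F` minus
`p`, for every `t`. -/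
lemma exists_mem_iff [CharP K p] (h : IsTransform p k t F F') (m : ℕ) :
    (∃ l, expo k m l ∈ support p F') ↔ ∃ a b, expo k a b ∈ support p F ∧ a + b = m + p := by
  simp only [h.mem_iff]
  rw [exists_coeff_taylor_iff]
  constructor
  · rintro ⟨l, h1, h2⟩
    obtain ⟨h3, h4⟩ := mem_support_of_coeff_slice_ne_zero h1 h2
    exact ⟨_, _, h4, by omega⟩
  · rintro ⟨a, b, h1, h2⟩
    rw [← h2]
    exact ⟨b, coeff_slice_ne_zero_of_mem_support h1⟩

lemma mem_zero_iff (h : IsTransform p k 0 F F') {m a b : ℕ} (hab : a + b = m + p) :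
    expo k m b ∈ support p F' ↔ expo k a b ∈ support p F := by
  rw [h.mem_iff, Polynomial.taylor_zero, ← hab]
  refine ⟨fun h' => ?_, coeff_slice_ne_zero_of_mem_support⟩
  have := (mem_support_of_coeff_slice_ne_zero h'.1 h'.2).2
  rwa [Nat.add_sub_cancel] at this

lemma exists_mem_of_mem_zero (h : IsTransform p k 0 F F') {m b : ℕ}
    (h' : expo k m b ∈ support p F') : ∃ a, a + b = m + p ∧ expo k a b ∈ support p F := by
  obtain ⟨h1, h2⟩ := h.mem_iff.mp h'
  rw [Polynomial.taylor_zero] at h1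
  obtain ⟨h3, h4⟩ := mem_support_of_coeff_slice_ne_zero h1 h2
  exact ⟨_, by omega, h4⟩

end IsTransform

end Kangaroo

namespace Kangaroo

variable {K : Type*} [Field K] {p : ℕ}

/-! ### Change of the dorder under one blowup -/

namespace IsTransform

variable {k : Fin 2} {t : K} {F F' : MvPowerSeries (Fin 2) K}

/-- If the dorder increases under a blowup, then the initial form of the antelope contains the
extreme monomials `w ^ r * X k ^ d` and `w ^ r * X k.rev ^ d`, and both exponents in `w ^ r` are
prime to `p`. -/
lemma mem_support_of_dorder_lt [CharP K p] (h : IsTransform p k t F F') {E E' : Finset (Fin 2)}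
    (hE : ∀ w, w ∈ E' ↔ w = k ∨ t = 0 ∧ w ∈ E) {r s d : ℕ} (hd : dorder p E F = d)
    (hr : excOrd p E k F = r) (hs : excOrd p E k.rev F = s) (hpos : 0 < d)
    (hlt : d < dorder p E' F') :
    expo k (r + d) s ∈ support p F ∧ expo k r (s + d) ∈ support p F ∧ ¬ p ∣ r ∧ ¬ p ∣ s := by
  have hF : (support p F).Nonempty := support_nonempty_of_dorder_pos (hd ▸ hpos)
  have hF' : (support p F').Nonempty := support_nonempty_of_dorder_pos (hpos.trans hlt)
  have ho := ord_eq_add_dorder E k hF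
  have ho' := ord_eq_add_dorder E' k hF'
  rw [hd, hr, hs] at ho
  obtain ⟨a, b, hab, habo⟩ := exists_mem_support_ord k hF
  obtain ⟨m, hm⟩ := Nat.exists_eq_add_of_le' (h.le_of_mem hab)
  have hbounds : ∀ i, i ≤ m + p → expo k (m + p - i) i ∈ support p F → s ≤ i ∧ i ≤ s + d := by
    intro i hi hmem
    have h1 := excOrd_le (E := E) hmem
    have h2 := excOrd_rev_le (E := E) hmem
    omega
  have hm' : m ≤ excOrd p E' k F' := by
    rw [excOrd, if_pos ((hE k).mpr (Or.inl rfl))]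
    refine le_ordAlong hF' fun a' b' hab' => ?_
    obtain ⟨a₁, b₁, h1, h2⟩ := (h.exists_mem_iff a').mp ⟨b', hab'⟩
    have := ord_le h1
    omega
  -- The new curve already absorbs at least `m` of the order of `F'`; the rest of that order bounds
  -- `l`.
  have hup : ∀ l, expo k m l ∈ support p F' → dorder p E' F' + excOrd p E' k.rev F' ≤ l := by
    intro l hl
    have := ord_le hl
    omega
  -- At the origin of the chart the initial monomial keeps its exponent `b ≤ s + d`, and the old
  -- component `X k.rev` still absorbs at least `s`, so the dorder cannot grow.
  by_cases ht : t = 0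
  · subst ht
    have h1 := hup b ((h.mem_zero_iff hm).mpr hab)
    have h2 : s ≤ excOrd p E' k.rev F' := by
      by_cases hk : k.rev ∈ E
      · rw [excOrd, if_pos ((hE _).mpr (Or.inr ⟨rfl, hk⟩))]
        refine le_ordAlong hF' fun b' a' hab' => ?_
        rw [expo_rev] at hab'
        obtain ⟨c, -, hc⟩ := h.exists_mem_of_mem_zero hab'
        exact hs ▸ excOrd_rev_le hc
      · rw [← hs, excOrd, if_neg hk]
        exact Nat.zero_le _
    have h3 := excOrd_le (E := E) hab
    omega
  have hcoeff : ∀ l, l ≤ d → ¬ (p ∣ m + p ∧ p ∣ l) →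
      (Polynomial.taylor t (slice k F (m + p))).coeff l = 0 := by
    intro l hl hpl
    by_contra hne
    have := hup l (h.mem_iff.mpr ⟨hne, hpl⟩)
    omega
  have hne := coeff_slice_ne_zero_of_mem_support hab
  rw [hm] at hne
  by_cases hpm : p ∣ m + p
  -- The derivative discards the `p`-th powers; the factor `X` restores the exponents to `[s, s +
  -- d]`.
  · set U := Polynomial.X * Polynomial.derivative (slice k F (m + p)) with hU
    have hcU : ∀ i, U.coeff i = (slice k F (m + p)).coeff i * i := by
      intro i
      rcases i with _ | i
      · simp [hU]
      · rw [hU, Polynomial.coeff_X_mul, Polynomial.coeff_derivative]; push_cast; rfl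
    have hcU' : ∀ i, U.coeff i ≠ 0 →
        ¬ p ∣ i ∧ i ≤ m + p ∧ expo k (m + p - i) i ∈ support p F := by
      intro i hi
      rw [hcU] at hi
      have hpi : ¬ p ∣ i := by
        rw [← CharP.cast_eq_zero_iff K]
        exact right_ne_zero_of_mul hi
      exact ⟨hpi, mem_support_of_coeff_slice_ne_zero (left_ne_zero_of_mul hi) fun h' => hpi h'.2⟩
    have hU0 : U ≠ 0 := by
      refine mul_ne_zero Polynomial.X_ne_zero fun h0 => hne.2 ⟨hpm, ?_⟩
      exact derivative_eq_zero_iff_coeff.mp h0 b hne.1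
    have hdvd : (Polynomial.X - Polynomial.C t) ^ d ∣ U := by
      refine Dvd.dvd.mul_left (Polynomial.X_sub_C_pow_dvd_of_X_pow_dvd_taylor ?_) _
      rw [← Polynomial.derivative_taylor', Polynomial.X_pow_dvd_iff]
      intro l hl
      rw [Polynomial.coeff_derivative]
      by_cases hpl : p ∣ l + 1
      · have := (CharP.cast_eq_zero_iff K p _).mpr hpl
        push_cast at this
        rw [this, mul_zero]
      · rw [hcoeff (l + 1) (by omega) fun h' => hpl h'.2, zero_mul]
    obtain ⟨h1, h2⟩ := Polynomial.coeff_ne_zero_of_X_sub_C_pow_dvd hU0 ht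
      (fun i hi => hbounds i (hcU' i hi).2.1 (hcU' i hi).2.2) hdvd
    obtain ⟨hp1, -, hs1⟩ := hcU' _ h1
    obtain ⟨hp2, -, hs2⟩ := hcU' _ h2
    rw [show m + p - s = r + d by omega] at hs1
    rw [show m + p - (s + d) = r by omega] at hs2
    refine ⟨hs1, hs2, fun hpr => hp2 ?_, hp1⟩
    rw [show m + p = r + (s + d) by omega] at hpm
    exact (Nat.dvd_add_right hpr).mp hpm
  -- No `p`-th powers occur in this degree, so `t` would be a root of multiplicity `d + 1`.
  · exfalso
    have hU0 : slice k F (m + p) ≠ 0 := fun h0 => hne.1 (by rw [h0, Polynomial.coeff_zero])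
    have := Polynomial.le_of_X_sub_C_pow_dvd (n := d + 1) (s := s) (d := d) hU0 ht
      (fun i hi => by
        obtain ⟨h1, h2⟩ := mem_support_of_coeff_slice_ne_zero hi fun h' => hpm h'.1
        exact hbounds i h1 h2)
      (Polynomial.X_sub_C_pow_dvd_of_X_pow_dvd_taylor (Polynomial.X_pow_dvd_iff.mpr
        fun l hl => hcoeff l (by omega) fun h' => hpm h'.1))
    omega

/-- A lower bound for the dorder in terms of the support after one blowup. -/
lemma le_dorder [CharP K p] (h : IsTransform p k t F F') (E : Finset (Fin 2)) {A D s c : ℕ}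
    (hs : ¬ p ∣ s) (hmin : ∀ a b, expo k a b ∈ support p F' → s ≤ a)
    (hcol : ∀ b, expo k s b ∈ support p F' → A + D ≤ b)
    (h1 : expo k s (A + D) ∈ support p F') (h2 : expo k c A ∈ support p F') :
    D ≤ dorder p E F := by
  obtain ⟨a₀, b₀, hab₀, hsum₀⟩ := (h.exists_mem_iff s).mp ⟨_, h1⟩
  have hF : (support p F).Nonempty := ⟨_, hab₀⟩
  obtain ⟨a, b, hab, ho⟩ := exists_mem_support_ord k hF
  -- `s` is the order of `F'` along the new curve.
  have hord : ord p F = s + p := by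
    refine le_antisymm (hsum₀ ▸ ord_le hab₀) ?_
    obtain ⟨m, hm⟩ := Nat.exists_eq_add_of_le' (h.le_of_mem hab)
    obtain ⟨l, hl⟩ := (h.exists_mem_iff m).mpr ⟨a, b, hab, hm⟩
    have := hmin _ _ hl
    omega
  have hd := ord_eq_add_dorder E k hF
  have hps : ¬ p ∣ s + p := by rwa [Nat.dvd_add_self_right]
  have hbounds : ∀ i, (slice k F (s + p)).coeff i ≠ 0 →
      excOrd p E k.rev F ≤ i ∧ i ≤ excOrd p E k.rev F + dorder p E F := by
    intro i hi
    obtain ⟨h3, h4⟩ := mem_support_of_coeff_slice_ne_zero hi fun h' => hps h'.1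
    have h5 := excOrd_le (E := E) h4
    have h6 := excOrd_rev_le (E := E) h4
    omega
  -- If `t = 0`, the monomial with exponent `A` bounds the order along `X k.rev`, while the initial
  -- form reaches exponent `A + D`. If `t ≠ 0`, the initial form has a root of multiplicity at least
  -- `A + D`, which bounds the dorder directly.
  by_cases ht : t = 0
  · subst ht
    obtain ⟨a', -, ha'⟩ := h.exists_mem_of_mem_zero h2
    have h3 := excOrd_rev_le (E := E) ha'
    have h4 := (h.mem_iff.mp h1).1
    rw [Polynomial.taylor_zero] at h4
    have := (hbounds _ h4).2
    omega
  · have hU0 : slice k F (s + p) ≠ 0 := by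
      intro h0
      have := (h.mem_iff.mp h1).1
      simp [h0] at this
    have := Polynomial.le_of_X_sub_C_pow_dvd (n := A + D) hU0 ht hbounds
      (Polynomial.X_sub_C_pow_dvd_of_X_pow_dvd_taylor (Polynomial.X_pow_dvd_iff.mpr fun l hl => by
        by_contra hne
        have := hcol l (h.mem_iff.mpr ⟨hne, fun h' => hps h'.1⟩)
        omega))
    omega

end IsTransform

/-! ### Iterated monomial blowups -/

lemma exists_mem_support_of_iterate {k : Fin 2} {G : ℕ → MvPowerSeries (Fin 2) K} {q : ℕ}
    (h : ∀ i < q, IsTransform p k 0 (G i) (G (i + 1))) {a b : ℕ}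
    (hab : expo k a b ∈ support p (G 0)) :
    ∃ a', a + q * b = a' + q * p ∧ expo k a' b ∈ support p (G q) := by
  induction q with
  | zero => exact ⟨a, by simp, hab⟩
  | succ q ih =>
    obtain ⟨a', h1, h2⟩ := ih fun i hi => h i (by omega)
    have hq := h q (by omega)
    obtain ⟨m, hm⟩ := Nat.exists_eq_add_of_le' (hq.le_of_mem h2)
    exact ⟨m, by linarith, (hq.mem_zero_iff hm).mpr h2⟩

lemma exists_mem_support_of_mem_iterate {k : Fin 2} {G : ℕ → MvPowerSeries (Fin 2) K} {q : ℕ}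
    (h : ∀ i < q, IsTransform p k 0 (G i) (G (i + 1))) {a' b : ℕ}
    (hab : expo k a' b ∈ support p (G q)) :
    ∃ a, a + q * b = a' + q * p ∧ expo k a b ∈ support p (G 0) := by
  induction q generalizing a' with
  | zero => exact ⟨a', by simp, hab⟩
  | succ q ih =>
    obtain ⟨m, hm, h2⟩ := (h q (by omega)).exists_mem_of_mem_zero hab
    obtain ⟨a, h3, h4⟩ := ih (fun i hi => h i (by omega)) h2
    exact ⟨a, by linarith, h4⟩

/-- The dorder drops at least to the fraction `1 / (q + 1)` under a blowup in the chart of `X k`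
followed by `q` monomial blowups in the other chart, if the initial form of the final series
contains the extreme monomials and its order `s` along `X k` is prime to `p`. -/
lemma succ_mul_le_dorder [CharP K p] {k : Fin 2} {t : K} {F : MvPowerSeries (Fin 2) K}
    {G : ℕ → MvPowerSeries (Fin 2) K} {q : ℕ} (h0 : IsTransform p k t F (G 0))
    (h : ∀ i < q, IsTransform p k.rev 0 (G i) (G (i + 1))) (E : Finset (Fin 2)) {r s d : ℕ}
    (hs : ¬ p ∣ s)
    (hmin : ∀ a b, expo k a b ∈ support p (G q) → s ≤ a ∧ r + s + d ≤ a + b)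
    (h1 : expo k s (r + d) ∈ support p (G q)) (h2 : expo k (s + d) r ∈ support p (G q)) :
    (q + 1) * d ≤ dorder p E F := by
  rw [← expo_rev] at h1 h2
  obtain ⟨B, hB, hB'⟩ := exists_mem_support_of_mem_iterate h h1
  obtain ⟨A, hA, hA'⟩ := exists_mem_support_of_mem_iterate h h2
  rw [expo_rev] at hA' hB'
  -- Each inverse step replaces the exponent `b` of `X k.rev` by `b + p - a`, where `a` is the
  -- exponent of `X k`. The values of `a` are `s` and `s + d`, so each step adds `d` to the initial
  -- gap `d`.
  have hBA : B = A + (q + 1) * d := by linarith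
  have hback : ∀ a b, expo k a b ∈ support p (G 0) →
      ∃ b', b + q * a = b' + q * p ∧ s ≤ a ∧ r + s + d ≤ a + b' := by
    intro a b hab
    rw [← expo_rev] at hab
    obtain ⟨b', h3, h4⟩ := exists_mem_support_of_iterate h hab
    rw [expo_rev] at h4
    exact ⟨b', h3, hmin _ _ h4⟩
  refine h0.le_dorder E (A := A) hs (fun a b hab => ?_) (fun b hb => ?_) (hBA ▸ hB') hA'
  · obtain ⟨-, -, h3, -⟩ := hback a b hab
    exact h3
  · obtain ⟨b', h3, -, h4⟩ := hback s b hb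
    linarith

namespace BlowupSequence

variable {N : ℕ} (B : BlowupSequence K p N)

lemma isTransform (hp : p ≠ 0) {i : ℕ} (hi : i < N) :
    IsTransform p (B.chart i) (B.t i) (B.F i) (B.F (i + 1)) :=
  IsStrictTransform.isTransform hp (B.order_center i hi) (B.strict i hi)

/-! ### Exceptional components -/

lemma mem_exc_succ (i : ℕ) (w : Fin 2) :
    w ∈ B.exc (i + 1) ↔ w = B.chart i ∨ B.t i = 0 ∧ w ∈ B.exc i := by
  simp only [exc, born, Finset.mem_filter, Finset.mem_univ, true_and]
  by_cases h1 : w = B.chart i <;> by_cases h2 : B.t i = 0 <;> simp [h1, h2]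

lemma le_of_born_eq_some {i m : ℕ} {w : Fin 2} (h : B.born i w = some m) : m ≤ i := by
  induction i with
  | zero =>
    rw [born] at h
    split_ifs at h
    simp_all
  | succ i ih =>
    rw [born] at h
    split_ifs at h
    · simp_all
    · exact (ih h).trans (Nat.le_succ i)

lemma chart_eq_of_born_eq_some {i m : ℕ} {w : Fin 2} (h : B.born i w = some (m + 1)) :
    B.chart m = w := by
  induction i with
  | zero =>
    rw [born] at h
    split_ifs at h
    simp_all
  | succ i ih =>
    rw [born] at h
    split_ifs at h with h1
    · simp_all
    · exact ih h

/-- Either the chart of `X w` or a nonzero translation in the other chart would move the point off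
the component. -/
lemma chart_ne_of_born_eq_some {i m : ℕ} {w : Fin 2} (h : B.born i w = some m) {l : ℕ}
    (hml : m ≤ l) (hli : l < i) : B.chart l ≠ w ∧ B.t l = 0 := by
  induction i with
  | zero => omega
  | succ i ih =>
    rw [born] at h
    split_ifs at h with h1 h2
    · simp only [Option.some.injEq] at h
      omega
    · rcases Nat.lt_succ_iff_lt_or_eq.mp hli with h3 | rfl
      · exact ih h h3
      · exact ⟨fun h' => h1 h'.symm, h2⟩

end BlowupSequence

end Kangaroo

theorem mainTheorem9 {K : Type*} [Field K] [IsAlgClosed K] (p : ℕ) [Fact p.Prime] [CharP K p]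
    (n : ℕ) (B : Kangaroo.BlowupSequence K p (n + 1)) (hkangaroo : B.IsKangaroo n)
    (j : ℕ) (hj : B.IsLastBefore n j) :
    (B.dorderAt n : ℚ) ≤ (1 / 2 : ℚ) * (B.dorderAt j : ℚ) := by
  open Kangaroo in
  suffices h : 2 * B.dorderAt n ≤ B.dorderAt j by
    have : (2 : ℚ) * B.dorderAt n ≤ B.dorderAt j := by exact_mod_cast h
    linarith
  rcases Nat.eq_zero_or_pos (B.dorderAt n) with h0 | hpos
  · omega
  have hp : p ≠ 0 := (Fact.out : p.Prime).ne_zero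
  obtain ⟨d, hd⟩ : ∃ d, d = B.dorderAt n := ⟨_, rfl⟩
  have hF := support_nonempty_of_dorder_pos hpos
  -- the extreme monomials at the antelope point, in both orders of the coordinates
  have hext : ∀ k : Fin 2,
      let s := excOrd p (B.exc n) k (B.F n)
      let r := excOrd p (B.exc n) k.rev (B.F n)
      expo k s (r + d) ∈ support p (B.F n) ∧ expo k (s + d) r ∈ support p (B.F n) ∧
        ¬ p ∣ s := by
    intro k
    obtain ⟨h1, h2, h3, h4⟩ := (B.isTransform hp n.lt_succ_self).mem_support_of_dorder_lt
      (B.mem_exc_succ n) rfl rfl rfl hpos hkangaroo.2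
    rw [show dorder p (B.exc n) (B.F n) = d from hd.symm] at h1 h2
    rcases eq_or_eq_rev (B.chart n) k with rfl | rfl
    · exact ⟨h2, h1, h3⟩
    · simp only [Fin.rev_rev, expo_rev]
      exact ⟨h1, h2, h4⟩
  have hborn : ∀ w, ∃ m, B.born n w = some m := by
    intro w
    rw [← Option.isSome_iff_exists]
    by_contra hw
    -- A non-exceptional curve has exceptional order `0`, which is divisible by `p`.
    refine (hext w).2.2 ?_
    rw [excOrd, if_neg (by simpa [BlowupSequence.exc] using hw)]
    exact dvd_zero p
  -- the component `X k = 0` has appeared at `b_{j+1}`, the other one later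
  obtain ⟨hjn, hjlt⟩ := hj.1
  obtain ⟨k, hk⟩ : ∃ k, B.born n k = some (j + 1) := by
    by_contra hno
    push Not at hno
    have hlt : ∀ w m, B.born n w = some m → j + 1 < m := fun w m hw =>
      lt_of_le_of_ne (hjlt w m hw) fun h => hno w (h ▸ hw)
    obtain ⟨m, hm⟩ := hborn 0
    have := hlt 0 m hm
    have := B.le_of_born_eq_some hm
    have := hj.2 (show j + 1 ∈ _ from ⟨by omega, hlt⟩)
    omega
  have hchart := B.chart_eq_of_born_eq_some hk
  obtain ⟨m', hm'⟩ := hborn k.rev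
  have hjm' : j + 1 ≠ m' := by
    rintro rfl
    exact rev_ne_self k ((B.chart_eq_of_born_eq_some hm').symm.trans hchart)
  have := hjlt _ _ hm'
  have := B.le_of_born_eq_some hm'
  obtain ⟨q, hq⟩ := Nat.exists_eq_add_of_lt (show j + 1 < n by omega)
  -- Survival of the older component `X k = 0` makes all these blowups monomial in the other chart.
  have hstep : ∀ i < q + 1,
      IsTransform p k.rev 0 (B.F (j + 1 + i)) (B.F (j + 1 + (i + 1))) := by
    intro i hi
    obtain ⟨h1, h2⟩ := B.chart_ne_of_born_eq_some hk (l := j + 1 + i) (by omega) (by omega)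
    have h3 := B.isTransform hp (i := j + 1 + i) (by omega)
    rwa [(eq_or_eq_rev k _).resolve_left h1, h2] at h3
  have hfirst := B.isTransform hp (i := j) (by omega)
  rw [hchart] at hfirst
  have hnq : j + 1 + (q + 1) = n := by omega
  have hmain := succ_mul_le_dorder (G := fun i => B.F (j + 1 + i)) (q := q + 1) hfirst hstep
    (B.exc j) (r := excOrd p (B.exc n) k.rev (B.F n)) (d := d) (hext k).2.2
    (fun a b hab => by
      simp only [hnq] at hab
      have h1 := excOrd_le (E := B.exc n) hab
      have h2 := ord_le hab
      have h3 := ord_eq_add_dorder (B.exc n) k hF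
      have h4 : dorder p (B.exc n) (B.F n) = d := hd.symm
      omega)
    (by simpa only [hnq] using (hext k).1) (by simpa only [hnq] using (hext k).2.1)
  rw [← hd]
  -- With `q + 1` monomial blowups the factor is `q + 2 ≥ 2`.
  exact (Nat.mul_le_mul_right d (by omega)).trans hmain
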